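/- Consider the discrete-time descriptor system $$E x(k+1)=A x(k)+B u(k),\qquad y(k)=C x(k),\qquad k=0,1,2,\dots,\tag{1}$$ with $E,A\in\mathbb R^{n\times n}$, $B\in\mathbb R^{n\times m}$, $C\in\mathbb R^{p\times n}$, which is regular: $\det(\lambda E-A)\neq 0$ for some $\lambda\in\mathbb C$. Let $S,P\in\mathbb R^{n\times n}$ be invertible with $$SEP=\begin{bmatrix} I_{n_1}&0\\0&R\end{bmatrix},\qquad SAP=\begin{bmatrix}A_1&0\\0&I_{n_2}\end{bmatrix},\qquad CP=[\,C_1\ \ C_2\,],$$ where $n_1+n_2=n$ and $R$ is nilpotent, with nilpotency index $s$ (the least $s\ge 0$ with $R^s=0$; so $s=0$ if $n_2=0$). For a state $x$ let $z_1\in\mathbb R^{n_1}$ be the first $n_1$ entries of $P^{-1}x$. Let inputs $u_d(0),\dots,u_d(T+s-1)$, states $x_d(0),\dots,x_d(T)$ and outputs $y_d(0),\dots,y_d(T)$ be recorded along a trajectory of (1) (that is, they are initial pieces of sequences $u,x,y$ on $\{0,1,2,\dots\}$ satisfying (1)), and put $$U_p=[u_d(0),\dots,u_d(T-1)],\quad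 X_p=[x_d(0),\dots,x_d(T-1)],\quad X_f=[x_d(1),\dots,x_d(T)],$$ $$Y_p=[y_d(0),\dots,y_d(T-1)],\quad Y_f=[y_d(1),\dots,y_d(T)].$$ **Assumption 1.** The fast subsystem is observable: $\mathrm{rk}\,[C_2^\top,\,R^\top C_2^\top,\dots,(R^{n_2-1})^\top C_2^\top]^\top=n_2$ (equivalently, $\mathrm{rk}\begin{bmatrix}E\\C\end{bmatrix}=n$). **Assumption 2.** The matrix $$\begin{bmatrix} z_{1d}(0)&z_{1d}(1)&\cdots&z_{1d}(T-1)\\ u_d(0)&u_d(1)&\cdots&u_d(T-1)\\ \vdots&\vdots&&\vdots\\ u_d(s)&u_d(s+1)&\cdots&u_d(T+s-1)\end{bmatrix}$$ has full row rank $n_1+(s+1)m$, where $z_{1d}(k)$ is the vector $z_1$ of $x_d(k)$. **Theorem.** Under Assumptions 1 and 2 the following statements are equivalent. (i) There is a state observer of the form $$\hat x(k+1)=A_O\hat x(k)+B_O^u u(k)+B_O^y y(k)+N_O y(k+1),$$ i.e. there are real matrices $A_O,B_O^u,B_O^y,N_O$ such that $\lim_{k\to\infty}\|x(k)-\hat x(k)\|=0$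 for every trajectory $(u,x,y)$ of (1) and every initial estimate $\hat x(0)\in\mathbb R^n$. (ii) There are real matrices $\Sigma_{X_p},\Sigma_{U_p},\Sigma_{Y_p},\Sigma_{Y_f}$ with $$X_f=\Sigma_{X_p}X_p+\Sigma_{U_p}U_p+\Sigma_{Y_p}Y_p+\Sigma_{Y_f}Y_f$$ and $\Sigma_{X_p}$ Schur stable (all its eigenvalues have modulus less than $1$). (iii) For all $\lambda\in\mathbb C$ with $|\lambda|\ge 1$, $$\mathrm{rk}\begin{bmatrix}\lambda X_p-X_f\\U_p\\Y_p\\Y_f\end{bmatrix}=\mathrm{rk}\begin{bmatrix}X_p\\U_p\\Y_f\end{bmatrix}.$$ (iv) System (1) is detectable, i.e. its dual $(E^\top,A^\top,C^\top)$ is stabilizable: there is $K\in\mathbb R^{p\times n}$ such that every $\lambda\in\mathbb C$ with $\det\bigl(\lambda E^\top-(A^\top+C^\top K)\bigr)=0$ satisfies $|\lambda|<1$. -/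

import Mathlib

open Matrix

/-- The matrices of the discrete-time linear descriptor system
`E x(k+1) = A x(k) + B u(k)`, `y(k) = C x(k)`. -/
structure DescriptorSystem (n m p : ℕ) where
  E : Matrix (Fin n) (Fin n) ℝ
  A : Matrix (Fin n) (Fin n) ℝ
  B : Matrix (Fin n) (Fin m) ℝ
  C : Matrix (Fin p) (Fin n) ℝ

/-- Entrywise inclusion of real matrices into complex matrices. -/
def toComplex {ι κ : Type*} (M : Matrix ι κ ℝ) : Matrix ι κ ℂ :=
  M.map (fun r : ℝ => (r : ℂ))

/-- The finite spectrum `σ(E, A)`, the set of complex `μ` with `det (μ E - A) = 0`. -/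
def finiteSpectrum {n : ℕ} (E A : Matrix (Fin n) (Fin n) ℝ) : Set ℂ :=
  {μ : ℂ | (μ • toComplex E - toComplex A).det = 0}

/-- All (complex) eigenvalues lie in the open unit disc. -/
def IsSchurStable {n : ℕ} (M : Matrix (Fin n) (Fin n) ℝ) : Prop :=
  ∀ μ ∈ spectrum ℂ (toComplex M), ‖μ‖ < 1

/-- `(E, A, B)` is stabilizable: some state feedback `K` places the finite spectrum
of `(E, A + B K)` inside the open unit disc. -/
def IsStabilizable {n m : ℕ} (E A : Matrix (Fin n) (Fin n) ℝ) (B : Matrix (Fin n) (Fin m) ℝ) :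
    Prop :=
  ∃ K : Matrix (Fin m) (Fin n) ℝ, ∀ μ ∈ finiteSpectrum E (A + B * K), ‖μ‖ < 1

namespace DescriptorSystem

/-- Regularity: `det (μ E - A) ≠ 0` for some complex `μ`. -/
def IsRegular {n m p : ℕ} (sys : DescriptorSystem n m p) : Prop :=
  ∃ μ : ℂ, (μ • toComplex sys.E - toComplex sys.A).det ≠ 0

/-- Detectability: the dual system `(Eᵀ, Aᵀ, Cᵀ)` is stabilizable. -/
def IsDetectable {n m p : ℕ} (sys : DescriptorSystem n m p) : Prop :=
  IsStabilizable sys.Eᵀ sys.Aᵀ sys.Cᵀ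

/-- `(u, x, y)` is an input/state/output trajectory of the system on `{0, 1, 2, …}`. -/
def IsTrajectory {n m p : ℕ} (sys : DescriptorSystem n m p)
    (u : ℕ → Fin m → ℝ) (x : ℕ → Fin n → ℝ) (y : ℕ → Fin p → ℝ) : Prop :=
  ∀ k : ℕ, sys.E *ᵥ x (k + 1) = sys.A *ᵥ x k + sys.B *ᵥ u k ∧ y k = sys.C *ᵥ x k

/-- The recursion
`x̂(k+1) = A_O x̂(k) + B_O^u u(k) + B_O^y y(k) + N_O y(k+1)`
is a state observer: along every trajectory of the system and from every initial estimate
`x̂(0)`, the estimation error tends to zero. -/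
def IsObserver {n m p : ℕ} (sys : DescriptorSystem n m p)
    (AO : Matrix (Fin n) (Fin n) ℝ) (BOu : Matrix (Fin n) (Fin m) ℝ)
    (BOy : Matrix (Fin n) (Fin p) ℝ) (NO : Matrix (Fin n) (Fin p) ℝ) : Prop :=
  ∀ (u : ℕ → Fin m → ℝ) (x : ℕ → Fin n → ℝ) (y : ℕ → Fin p → ℝ), sys.IsTrajectory u x y →
    ∀ xhat : ℕ → Fin n → ℝ,
      (∀ k : ℕ, xhat (k + 1) = AO *ᵥ xhat k + BOu *ᵥ u k + BOy *ᵥ y k + NO *ᵥ y (k + 1)) →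
      Filter.Tendsto (fun k : ℕ => ‖x k - xhat k‖) Filter.atTop (nhds 0)

/-- A decomposition of the system into a slow and a fast subsystem: invertible matrices `S`, `P`
with `S E P = diag(I, R)`, `S A P = diag(A₁, I)` and `R` nilpotent. The columns of `P` and the
rows of `S` are indexed by the disjoint union of the slow and the fast indices; invertibility
forces `n₁ + n₂ = n`. -/
structure Decomposition {n m p : ℕ} (sys : DescriptorSystem n m p) (n₁ n₂ : ℕ) where
  P : Matrix (Fin n) (Fin n₁ ⊕ Fin n₂) ℝ
  Pinv : Matrix (Fin n₁ ⊕ Fin n₂) (Fin n) ℝ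
  P_mul_Pinv : P * Pinv = 1
  Pinv_mul_P : Pinv * P = 1
  S : Matrix (Fin n₁ ⊕ Fin n₂) (Fin n) ℝ
  Sinv : Matrix (Fin n) (Fin n₁ ⊕ Fin n₂) ℝ
  S_mul_Sinv : S * Sinv = 1
  Sinv_mul_S : Sinv * S = 1
  A₁ : Matrix (Fin n₁) (Fin n₁) ℝ
  R : Matrix (Fin n₂) (Fin n₂) ℝ
  isNilpotent_R : IsNilpotent R
  decomp_E : S * sys.E * P = fromBlocks 1 0 0 R
  decomp_A : S * sys.A * P = fromBlocks A₁ 0 0 1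

namespace Decomposition

/-- The nilpotency index `s` of `R`: the least `s` with `R ^ s = 0`. -/
noncomputable def s {n m p n₁ n₂ : ℕ} {sys : DescriptorSystem n m p}
    (D : sys.Decomposition n₁ n₂) : ℕ :=
  nilpotencyClass D.R

/-- The block `C₂` of `C P = [C₁, C₂]`. -/
def C₂ {n m p n₁ n₂ : ℕ} {sys : DescriptorSystem n m p}
    (D : sys.Decomposition n₁ n₂) : Matrix (Fin p) (Fin n₂) ℝ :=
  (sys.C * D.P).submatrix id Sum.inr

/-- The observability matrix `col{C₂, C₂ R, …, C₂ R ^ (n₂ - 1)}` of the fast subsystem. -/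
def fastObservabilityMatrix {n m p n₁ n₂ : ℕ} {sys : DescriptorSystem n m p}
    (D : sys.Decomposition n₁ n₂) : Matrix (Fin n₂ × Fin p) (Fin n₂) ℝ :=
  Matrix.of fun i j => (D.C₂ * D.R ^ (i.1 : ℕ)) i.2 j

/-- The fast subsystem is observable. -/
def FastObservable {n m p n₁ n₂ : ℕ} {sys : DescriptorSystem n m p}
    (D : sys.Decomposition n₁ n₂) : Prop :=
  D.fastObservabilityMatrix.rank = n₂

/-- The slow component `z₁` of `z = P⁻¹ x`. -/
def slowState {n m p n₁ n₂ : ℕ} {sys : DescriptorSystem n m p}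
    (D : sys.Decomposition n₁ n₂) (x : Fin n → ℝ) : Fin n₁ → ℝ :=
  fun i => (D.Pinv *ᵥ x) (Sum.inl i)

end Decomposition

end DescriptorSystem

/-- The Hankel matrix of depth `l + 1` (with `T` columns) of `f(0), …, f(T + l - 1)`;
its block row `i` is `[f(i), f(i+1), …, f(i+T-1)]`. -/
def hankel {q T : ℕ} (l : ℕ) (f : Fin (T + l) → Fin q → ℝ) :
    Matrix (Fin (l + 1) × Fin q) (Fin T) ℝ :=
  Matrix.of fun i j => f ⟨(j : ℕ) + (i.1 : ℕ), by omega⟩ i.2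

/-- Recorded data: inputs `u_d(0), …, u_d(T+s-1)`, states `x_d(0), …, x_d(T)` and
outputs `y_d(0), …, y_d(T)`. -/
structure HistoricalData (n m p T s : ℕ) where
  u : Fin (T + s) → Fin m → ℝ
  x : Fin (T + 1) → Fin n → ℝ
  y : Fin (T + 1) → Fin p → ℝ

namespace HistoricalData

/-- `U_p = [u_d(0), …, u_d(T-1)]`. -/
def Up {n m p T s : ℕ} (d : HistoricalData n m p T s) : Matrix (Fin m) (Fin T) ℝ :=
  Matrix.of fun i k => d.u (Fin.castAdd s k) i

/-- `X_p = [x_d(0), …, x_d(T-1)]`. -/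
def Xp {n m p T s : ℕ} (d : HistoricalData n m p T s) : Matrix (Fin n) (Fin T) ℝ :=
  Matrix.of fun i k => d.x k.castSucc i

/-- `X_f = [x_d(1), …, x_d(T)]`. -/
def Xf {n m p T s : ℕ} (d : HistoricalData n m p T s) : Matrix (Fin n) (Fin T) ℝ :=
  Matrix.of fun i k => d.x k.succ i

/-- `Y_p = [y_d(0), …, y_d(T-1)]`. -/
def Yp {n m p T s : ℕ} (d : HistoricalData n m p T s) : Matrix (Fin p) (Fin T) ℝ :=
  Matrix.of fun i k => d.y k.castSucc i

/-- `Y_f = [y_d(1), …, y_d(T)]`. -/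
def Yf {n m p T s : ℕ} (d : HistoricalData n m p T s) : Matrix (Fin p) (Fin T) ℝ :=
  Matrix.of fun i k => d.y k.succ i

/-- The data are recorded along a trajectory of the system. -/
def CollectedFrom {n m p T s : ℕ} (d : HistoricalData n m p T s)
    (sys : DescriptorSystem n m p) : Prop :=
  ∃ (u : ℕ → Fin m → ℝ) (x : ℕ → Fin n → ℝ) (y : ℕ → Fin p → ℝ), sys.IsTrajectory u x y ∧
    (∀ k, d.u k = u k) ∧ (∀ k, d.x k = x k) ∧ (∀ k, d.y k = y k)

/-- Richness of the data: `col{H_1(z_{1d}), H_{s+1}(u_d)}` has full row rank, where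
`z_{1d}(0), …, z_{1d}(T-1)` are the slow components of the recorded states. -/
def IsRich {n m p n₁ n₂ T : ℕ} {sys : DescriptorSystem n m p} (D : sys.Decomposition n₁ n₂)
    (d : HistoricalData n m p T D.s) : Prop :=
  (fromRows (hankel (T := T) 0 (fun k => D.slowState (d.x k.castSucc)))
    (hankel D.s d.u)).rank = n₁ + (D.s + 1) * m

end HistoricalData

/-! Every statement is compared with the Hautus condition `HautusDetectable`: for |μ| ≥ 1, no
nonzero v has Av = μEv and Cv = 0. An observer forces it, because a bad v gives trajectories Re(cμ^k
v) with zero input and output that do not all decay (`IsObserver.isHautusDetectable`). Detectability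
is equivalent to it: output injection does not affect ker C, and conversely the slow pair can be
stabilized while the fast block contributes no finite eigenvalues (`Decomposition.isDetectable`).
Condition (ii) follows from it because fast observability makes col{E, C} left invertible, and a
left inverse can be chosen with stable error dynamics (`exists_observer_gains`). Both stabilizations
rest on `exists_isSchurStable_sub_mul`. The data enter through `IsRich.exists_combination`: samples
(x(0), u(0), x(1)) of any trajectory are combinations of data columns. Thus the identity in (ii) is
a recursion valid on all trajectories, with error Σ^k e(0), where Σ is the coefficient of X_p. For
(iii), the two kernels are nested, and their equality is the Hautus condition written in data
coordinates. -/

/-! ### Complexification of real matrices. -/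

section ToComplex

variable {ι κ l : Type*}

theorem toComplex_add (M N : Matrix ι κ ℝ) : toComplex (M + N) = toComplex M + toComplex N := by
  ext i j; simp [toComplex]

theorem toComplex_sub (M N : Matrix ι κ ℝ) : toComplex (M - N) = toComplex M - toComplex N := by
  ext i j; simp [toComplex]

theorem toComplex_mul [Fintype κ] (M : Matrix ι κ ℝ) (N : Matrix κ l ℝ) :
    toComplex (M * N) = toComplex M * toComplex N := by
  ext i j; simp [toComplex, Matrix.mul_apply]

theorem toComplex_one [DecidableEq ι] : toComplex (1 : Matrix ι ι ℝ) = 1 := by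
  ext i j; by_cases h : i = j <;> simp [toComplex, Matrix.one_apply, h]

theorem toComplex_zero : toComplex (0 : Matrix ι κ ℝ) = 0 := by
  ext i j; simp [toComplex]

theorem toComplex_transpose (M : Matrix ι κ ℝ) : toComplex Mᵀ = (toComplex M)ᵀ := rfl

theorem toComplex_fromRows (M : Matrix ι l ℝ) (N : Matrix κ l ℝ) :
    toComplex (fromRows M N) = fromRows (toComplex M) (toComplex N) := by
  ext (i | i) j <;> rfl

theorem toComplex_pow [Fintype ι] [DecidableEq ι] (M : Matrix ι ι ℝ) (k : ℕ) :
    toComplex (M ^ k) = toComplex M ^ k := by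
  induction k with
  | zero => simp [toComplex_one]
  | succ k ih => rw [pow_succ, pow_succ, toComplex_mul, ih]

/-- The entrywise real part of a complex vector. -/
def reVec (v : ι → ℂ) : ι → ℝ := fun i => (v i).re

/-- The entrywise imaginary part of a complex vector. -/
def imVec (v : ι → ℂ) : ι → ℝ := fun i => (v i).im

/-- The complex vector with given real and imaginary parts. -/
def complexVec (a b : ι → ℝ) : ι → ℂ := fun i => ⟨a i, b i⟩

theorem complexVec_reVec_imVec (v : ι → ℂ) : complexVec (reVec v) (imVec v) = v := rfl

theorem reVec_mulVec [Fintype κ] (M : Matrix ι κ ℝ) (v : κ → ℂ) :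
    reVec (toComplex M *ᵥ v) = M *ᵥ reVec v := by
  ext i; simp [reVec, toComplex, mulVec, dotProduct]

theorem imVec_mulVec [Fintype κ] (M : Matrix ι κ ℝ) (v : κ → ℂ) :
    imVec (toComplex M *ᵥ v) = M *ᵥ imVec v := by
  ext i; simp [imVec, toComplex, mulVec, dotProduct]

theorem toComplex_mulVec_complexVec [Fintype κ] (M : Matrix ι κ ℝ) (a b : κ → ℝ) :
    toComplex M *ᵥ complexVec a b = complexVec (M *ᵥ a) (M *ᵥ b) := by
  ext i
  apply Complex.ext
  · exact congrFun (reVec_mulVec M (complexVec a b)) i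
  · exact congrFun (imVec_mulVec M (complexVec a b)) i

theorem complexVec_eq_zero {a b : ι → ℝ} : complexVec a b = 0 ↔ a = 0 ∧ b = 0 := by
  simp [funext_iff, complexVec, Complex.ext_iff, forall_and]

/-- The kernel of a complexified real matrix consists of two copies of the real kernel. -/
def kerToComplexEquiv [Fintype κ] (M : Matrix ι κ ℝ) :
    LinearMap.ker (toComplex M).mulVecLin ≃ₗ[ℝ]
      LinearMap.ker M.mulVecLin × LinearMap.ker M.mulVecLin where
  toFun v := (⟨reVec v.1, by
      have h := v.2
      rw [LinearMap.mem_ker, mulVecLin_apply] at h ⊢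
      rw [← reVec_mulVec, h]; rfl⟩,
    ⟨imVec v.1, by
      have h := v.2
      rw [LinearMap.mem_ker, mulVecLin_apply] at h ⊢
      rw [← imVec_mulVec, h]; rfl⟩)
  invFun w := ⟨complexVec w.1.1 w.2.1, by
    have h := w.1.2
    have h' := w.2.2
    rw [LinearMap.mem_ker, mulVecLin_apply] at h h' ⊢
    rw [toComplex_mulVec_complexVec, complexVec_eq_zero]
    exact ⟨h, h'⟩⟩
  left_inv v := rfl
  right_inv w := rfl
  map_add' v w := rfl
  map_smul' r v := by
    ext i <;> simp [reVec, imVec]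

/-- Rank-nullity: the complex kernel has real dimension twice its complex dimension and is two
copies of the real kernel. This makes the real rank in (iii) comparable with the complex one. -/
theorem rank_toComplex [Fintype κ] (M : Matrix ι κ ℝ) : (toComplex M).rank = M.rank := by
  have h1 := (toComplex M).mulVecLin.finrank_range_add_finrank_ker
  have h2 := M.mulVecLin.finrank_range_add_finrank_ker
  have h3 := (kerToComplexEquiv M).finrank_eq
  rw [Module.finrank_prod, finrank_real_of_complex] at h3
  rw [Module.finrank_fintype_fun_eq_card] at h1 h2
  unfold Matrix.rank
  omega

end ToComplex

/-! ### Ranks and kernels. -/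

theorem rank_eq_iff_of_ker_le {ι ι' κ K : Type*} [Field K] [Fintype κ]
    {M : Matrix ι κ K} {N : Matrix ι' κ K} (h : ∀ g, N *ᵥ g = 0 → M *ᵥ g = 0) :
    M.rank = N.rank ↔ ∀ g, M *ᵥ g = 0 → N *ᵥ g = 0 := by
  have h1 := M.mulVecLin.finrank_range_add_finrank_ker
  have h2 := N.mulVecLin.finrank_range_add_finrank_ker
  have hle : LinearMap.ker N.mulVecLin ≤ LinearMap.ker M.mulVecLin := fun g hg => h g hg
  have key : M.rank = N.rank ↔ LinearMap.ker N.mulVecLin = LinearMap.ker M.mulVecLin := by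
    unfold Matrix.rank
    constructor
    · intro hr
      exact Submodule.eq_of_le_of_finrank_eq hle (by omega)
    · intro hk
      rw [hk] at h2
      omega
  rw [key]
  constructor
  · intro hk g hg
    have : g ∈ LinearMap.ker N.mulVecLin := hk ▸ hg
    exact this
  · intro hk
    exact le_antisymm hle fun g hg => hk g hg

theorem exists_left_inverse_of_mulVec_eq_zero {ι κ K : Type*} [Field K] [Fintype ι] [Fintype κ]
    [DecidableEq ι] [DecidableEq κ] (M : Matrix ι κ K) (h : ∀ v, M *ᵥ v = 0 → v = 0) :
    ∃ N : Matrix κ ι K, N * M = 1 := by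
  obtain ⟨g, hg⟩ := (Matrix.toLin' M).exists_leftInverse_of_injective
    (LinearMap.ker_eq_bot'.2 fun v hv => h v (by simpa using hv))
  refine ⟨LinearMap.toMatrix' g, ?_⟩
  rw [← LinearMap.toMatrix'_toLin' M, ← LinearMap.toMatrix'_comp, hg, LinearMap.toMatrix'_id]

theorem mulVec_surjective_of_rank_eq_card {ι κ K : Type*} [Field K] [Fintype ι] [Fintype κ]
    (M : Matrix ι κ K) (h : M.rank = Fintype.card ι) (w : ι → K) : ∃ g, M *ᵥ g = w := by
  have : LinearMap.range M.mulVecLin = ⊤ :=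
    Submodule.eq_top_of_finrank_eq (by rw [Module.finrank_fintype_fun_eq_card]; exact h)
  exact LinearMap.range_eq_top.1 this w

theorem eq_zero_of_mulVec_eq_zero_of_rank {ι κ K : Type*} [Field K] [Fintype κ]
    (M : Matrix ι κ K) (h : M.rank = Fintype.card κ) {v : κ → K} (hv : M *ᵥ v = 0) : v = 0 := by
  have h1 := M.mulVecLin.finrank_range_add_finrank_ker
  rw [Module.finrank_fintype_fun_eq_card] at h1
  have h2 : LinearMap.ker M.mulVecLin = ⊥ := Submodule.finrank_eq_zero.1 (by
    unfold Matrix.rank at h; omega)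
  exact (LinearMap.ker_eq_bot'.1 h2) v hv

/-! ### Stabilization by real output injection, and decay of Schur stable powers. -/

section Stabilization

/-- A Schur complement computation: one block product is evaluated in two ways, with no
invertibility required. -/
theorem det_add_mul_mul_det {ι κ R : Type*} [CommRing R] [Fintype ι] [DecidableEq ι] [Fintype κ]
    [DecidableEq κ] {M : Matrix ι ι R} {N : Matrix κ κ R} {V : Matrix ι κ R} (W : Matrix κ ι R)
    (h : M * V = V * N) : (M + V * W).det * N.det = M.det * (N + W * V).det := by
  have e : fromBlocks M V (-W) 1 * fromBlocks 1 (-V) 0 N = fromBlocks M 0 (-W) (N + W * V) := by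
    rw [fromBlocks_multiply]
    congr 1 <;> simp [h, add_comm]
  have := congrArg Matrix.det e
  rw [det_mul, det_fromBlocks_one₂₂, det_fromBlocks_zero₂₁, det_fromBlocks_zero₁₂] at this
  simpa using this

/-- Spectral deflation: the range of V is A-invariant with action L, and the correction VW trades
the spectrum of L for that of L - WV, leaving the rest unchanged. -/
theorem charpoly_sub_mul_mul_charpoly {ι κ R : Type*} [CommRing R] [Fintype ι] [DecidableEq ι]
    [Fintype κ] [DecidableEq κ] {A : Matrix ι ι R} {L : Matrix κ κ R} {V : Matrix ι κ R}
    (W : Matrix κ ι R) (h : A * V = V * L) :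
    (A - V * W).charpoly * L.charpoly = A.charpoly * (L - W * V).charpoly := by
  have hAV : A.map Polynomial.C * V.map Polynomial.C = V.map Polynomial.C * L.map Polynomial.C := by
    rw [← Matrix.map_mul, ← Matrix.map_mul, h]
  have hVW : (V * W).map Polynomial.C = V.map Polynomial.C * W.map Polynomial.C := Matrix.map_mul
  have hWV : (W * V).map Polynomial.C = W.map Polynomial.C * V.map Polynomial.C := Matrix.map_mul
  have key := det_add_mul_mul_det (M := A.charmatrix) (N := L.charmatrix)
    (V := V.map Polynomial.C) (W.map Polynomial.C) (by
      rw [charmatrix, charmatrix, Matrix.sub_mul, Matrix.mul_sub, RingHom.mapMatrix_apply,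
        RingHom.mapMatrix_apply, hAV]
      congr 1
      ext i j : 2
      rw [Matrix.scalar_apply, Matrix.scalar_apply, diagonal_mul, mul_diagonal, mul_comm])
  have e1 : (A - V * W).charmatrix = A.charmatrix + V.map Polynomial.C * W.map Polynomial.C := by
    rw [charmatrix, charmatrix, map_sub, RingHom.mapMatrix_apply _ (V * W), hVW]
    abel
  have e2 : (L - W * V).charmatrix = L.charmatrix + W.map Polynomial.C * V.map Polynomial.C := by
    rw [charmatrix, charmatrix, map_sub, RingHom.mapMatrix_apply _ (W * V), hWV]
    abel
  rw [Matrix.charpoly, Matrix.charpoly, Matrix.charpoly, Matrix.charpoly, e1, e2, key]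

open Classical in
/-- The number of eigenvalues outside the open unit disc, counted with multiplicity. -/
noncomputable def unstableCount {ι : Type*} [Fintype ι] [DecidableEq ι] (A : Matrix ι ι ℂ) : ℕ :=
  (A.charpoly.roots.filter fun μ => 1 ≤ ‖μ‖).card

/-- All roots belonging to L are unstable and none belonging to L - WV are, so the count drops by
the size of L, which is positive. -/
theorem unstableCount_sub_mul_lt {ι κ : Type*} [Fintype ι] [DecidableEq ι]
    [Fintype κ] [DecidableEq κ] [Nonempty κ] {A : Matrix ι ι ℂ} {L : Matrix κ κ ℂ}
    {V : Matrix ι κ ℂ} (W : Matrix κ ι ℂ) (h : A * V = V * L)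
    (hL : ∀ μ, L.charpoly.IsRoot μ → 1 ≤ ‖μ‖)
    (hL' : ∀ μ, (L - W * V).charpoly.IsRoot μ → ‖μ‖ < 1) :
    unstableCount (A - V * W) < unstableCount A := by
  classical
  have key := congrArg Polynomial.roots (charpoly_sub_mul_mul_charpoly W h)
  rw [Polynomial.roots_mul ((charpoly_monic _).mul (charpoly_monic _)).ne_zero,
    Polynomial.roots_mul ((charpoly_monic _).mul (charpoly_monic _)).ne_zero] at key
  have key2 := congrArg (fun s => (s.filter fun μ : ℂ => 1 ≤ ‖μ‖).card) key
  simp only [Multiset.filter_add, Multiset.card_add] at key2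
  rw [Multiset.filter_eq_self.2 fun μ hμ => hL μ (Polynomial.isRoot_of_mem_roots hμ),
    Multiset.filter_eq_nil.2 fun μ hμ => not_le.2 (hL' μ (Polynomial.isRoot_of_mem_roots hμ)),
    IsAlgClosed.card_roots_eq_natDegree, charpoly_natDegree_eq_dim, Multiset.card_zero] at key2
  have := Fintype.card_pos (α := κ)
  unfold unstableCount
  omega

/-- The Hautus test for detectability of the pencil `(E, A)` with output matrix `C`. -/
def HautusDetectable {ι κ : Type*} [Fintype ι] (E A : Matrix ι ι ℝ) (C : Matrix κ ι ℝ) : Prop :=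
  ∀ μ : ℂ, 1 ≤ ‖μ‖ → ∀ v : ι → ℂ, toComplex A *ᵥ v = μ • (toComplex E *ᵥ v) →
    toComplex C *ᵥ v = 0 → v = 0

theorem HautusDetectable.sub_mul {ι κ : Type*} [Fintype ι] [Fintype κ]
    {E A : Matrix ι ι ℝ} {C : Matrix κ ι ℝ} (h : HautusDetectable E A C) (F : Matrix ι κ ℝ) :
    HautusDetectable E (A - F * C) C := by
  intro μ hμ v hv hC
  refine h μ hμ v ?_ hC
  rwa [toComplex_sub, toComplex_mul, sub_mulVec, ← mulVec_mulVec, hC, mulVec_zero, sub_zero] at hv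

theorem unstableCount_toComplex_sub_lt {ι κ l : Type*} [Fintype ι] [DecidableEq ι] [Fintype κ]
    [Fintype l] [DecidableEq l] [Nonempty l] {A : Matrix ι ι ℝ} {C : Matrix κ ι ℝ}
    {V : Matrix ι l ℝ} {L : Matrix l l ℝ} (G : Matrix l κ ℝ) (h : A * V = V * L)
    (hL : ∀ μ, (toComplex L).charpoly.IsRoot μ → 1 ≤ ‖μ‖)
    (hL' : ∀ μ, (toComplex (L - G * (C * V))).charpoly.IsRoot μ → ‖μ‖ < 1) :
    unstableCount (toComplex (A - V * G * C)) < unstableCount (toComplex A) := by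
  rw [toComplex_sub, Matrix.mul_assoc, toComplex_mul]
  refine unstableCount_sub_mul_lt _ (by rw [← toComplex_mul, h, toComplex_mul]) hL ?_
  rwa [← toComplex_mul, ← toComplex_sub, Matrix.mul_assoc]

theorem exists_unstableCount_lt_of_real {ι κ : Type*} [Fintype ι] [DecidableEq ι] [Fintype κ]
    [DecidableEq κ] {A : Matrix ι ι ℝ} {C : Matrix κ ι ℝ} {r : ℝ} (hr : 1 ≤ |r|) {a : ι → ℝ}
    (ha : A *ᵥ a = r • a) (hC : C *ᵥ a ≠ 0) :
    ∃ F : Matrix ι κ ℝ, unstableCount (toComplex (A - F * C)) < unstableCount (toComplex A) := by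
  obtain ⟨c, hc⟩ := Function.ne_iff.1 hC
  -- One output that sees a is enough; the gain is chosen to make L - GCV = 0.
  let G : Matrix (Fin 1) κ ℝ := Matrix.of fun _ c' => if c' = c then r / (C *ᵥ a) c else 0
  refine ⟨_, unstableCount_toComplex_sub_lt (V := Matrix.of fun i (_ : Fin 1) => a i)
    (L := !![r]) G ?_ ?_ ?_⟩
  · ext i j
    have := congrFun ha i
    simpa [Matrix.mul_apply, mulVec, dotProduct, mul_comm] using this
  · intro μ hμ
    have : μ = r := by
      simpa [Polynomial.IsRoot, Matrix.eval_charpoly, toComplex, sub_eq_zero] using hμ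
    simpa [this] using hr
  · intro μ hμ
    have hz : (!![r] : Matrix (Fin 1) (Fin 1) ℝ) -
        G * (C * Matrix.of fun i (_ : Fin 1) => a i) = 0 := by
      have : ∑ j, C c j * a j ≠ 0 := hc
      ext i j
      simp [Matrix.mul_apply, G, mulVec, dotProduct, this]
    rw [hz, toComplex_zero] at hμ
    have : μ = 0 := by simpa [Polynomial.IsRoot] using hμ
    simp [this]

theorem exists_unstableCount_lt_of_nonreal {ι κ : Type*} [Fintype ι] [DecidableEq ι] [Fintype κ]
    [DecidableEq κ] {A : Matrix ι ι ℝ} {C : Matrix κ ι ℝ} {μ : ℂ} (hμ : 1 ≤ ‖μ‖) (him : μ.im ≠ 0)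
    {a b : ι → ℝ} (ha : A *ᵥ a = μ.re • a - μ.im • b) (hb : A *ᵥ b = μ.im • a + μ.re • b)
    (hC : ¬ (C *ᵥ a = 0 ∧ C *ᵥ b = 0)) :
    ∃ F : Matrix ι κ ℝ, unstableCount (toComplex (A - F * C)) < unstableCount (toComplex A) := by
  obtain ⟨c, hc⟩ : ∃ c, ¬ ((C *ᵥ a) c = 0 ∧ (C *ᵥ b) c = 0) := by
    by_contra! h
    exact hC ⟨funext fun c => (h c).1, funext fun c => (h c).2⟩
  set α := (C *ᵥ a) c with hα
  set β := (C *ᵥ b) c with hβ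
  have hαβ : α ^ 2 + β ^ 2 ≠ 0 := by
    intro h0
    exact hc ⟨by nlinarith [sq_nonneg α, sq_nonneg β], by nlinarith [sq_nonneg α, sq_nonneg β]⟩
  set σ := μ.re with hσ
  set ω := μ.im with hω
  -- The two equations say that L - GCV has trace 0 and determinant 0, so its characteristic
  -- polynomial is z². The witnesses come from Cramer's rule; the system has determinant -ω(α² +
  -- β²), nonzero because μ is not real.
  obtain ⟨g₀, g₁, h1, h2⟩ : ∃ g₀ g₁ : ℝ, g₀ * α + g₁ * β = 2 * σ ∧
      g₀ * (α * σ + β * ω) + g₁ * (β * σ - α * ω) = σ ^ 2 + ω ^ 2 := by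
    refine ⟨((2 * σ) * (β * σ - α * ω) - β * (σ ^ 2 + ω ^ 2)) / (-ω * (α ^ 2 + β ^ 2)),
      (α * (σ ^ 2 + ω ^ 2) - (2 * σ) * (α * σ + β * ω)) / (-ω * (α ^ 2 + β ^ 2)), ?_, ?_⟩
    · field_simp
      ring
    · field_simp
      ring
  let G : Matrix (Fin 2) κ ℝ := Matrix.of fun i c' => if c' = c then ![g₀, g₁] i else 0
  refine ⟨_, unstableCount_toComplex_sub_lt (V := Matrix.of fun i (j : Fin 2) => ![a i, b i] j)
    (L := !![σ, ω; -ω, σ]) G ?_ ?_ ?_⟩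
  · ext i j
    have h1 := congrFun ha i
    have h2 := congrFun hb i
    fin_cases j
    · simp [Matrix.mul_apply, mulVec, dotProduct, Fin.sum_univ_two] at h1 ⊢
      rw [h1]; ring
    · simp [Matrix.mul_apply, mulVec, dotProduct, Fin.sum_univ_two] at h2 ⊢
      rw [h2]; ring
  · intro z hz
    rw [Polynomial.IsRoot, Matrix.eval_charpoly, Matrix.det_fin_two] at hz
    simp [toComplex] at hz
    have hz' : (z - μ) * (z - (starRingEnd ℂ) μ) = 0 := by
      rw [← hz, ← Complex.re_add_im μ]
      simp only [map_add, map_mul, Complex.conj_ofReal, Complex.conj_I]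
      linear_combination (-(μ.im : ℂ) ^ 2) * Complex.I_sq
    rcases mul_eq_zero.1 hz' with h | h
    · rwa [sub_eq_zero.1 h]
    · rwa [sub_eq_zero.1 h, Complex.norm_conj]
  · intro z hz
    have hM : (!![σ, ω; -ω, σ] : Matrix (Fin 2) (Fin 2) ℝ) -
        G * (C * Matrix.of fun i (j : Fin 2) => ![a i, b i] j) =
        !![σ - g₀ * α, ω - g₀ * β; -ω - g₁ * α, σ - g₁ * β] := by
      ext i j
      fin_cases i <;> fin_cases j <;>
        simp [Matrix.mul_apply, G, hα, hβ, mulVec, dotProduct]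
    rw [hM, Polynomial.IsRoot, Matrix.eval_charpoly, Matrix.det_fin_two] at hz
    simp [toComplex] at hz
    have h1' : (g₀ : ℂ) * α + g₁ * β = 2 * σ := by exact_mod_cast h1
    have h2' : (g₀ : ℂ) * (α * σ + β * ω) + g₁ * (β * σ - α * ω) = σ ^ 2 + ω ^ 2 := by
      exact_mod_cast h2
    have : z ^ 2 = 0 := by
      linear_combination hz - z * h1' + h2'
    simp [pow_eq_zero_iff (two_ne_zero) |>.1 this]

theorem exists_isSchurStable_sub_mul {n : ℕ} {κ : Type*} [Fintype κ]
    (A : Matrix (Fin n) (Fin n) ℝ) (C : Matrix κ (Fin n) ℝ) (h : HautusDetectable 1 A C) :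
    ∃ F : Matrix (Fin n) κ ℝ, IsSchurStable (A - F * C) := by
  classical
  -- Each injection lowers the unstable count and preserves the Hautus condition; successive
  -- injections add up.
  induction hN : unstableCount (toComplex A) using Nat.strong_induction_on generalizing A with
  | _ N ih =>
  subst hN
  by_cases hs : IsSchurStable A
  · exact ⟨0, by simpa using hs⟩
  suffices ∃ F : Matrix (Fin n) κ ℝ,
      unstableCount (toComplex (A - F * C)) < unstableCount (toComplex A) by
    obtain ⟨F, hF⟩ := this
    obtain ⟨F', hF'⟩ := ih _ hF (A - F * C) (h.sub_mul F) rfl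
    exact ⟨F + F', by rwa [Matrix.add_mul, ← sub_sub]⟩
  obtain ⟨μ, hμ, hμ1⟩ : ∃ μ ∈ spectrum ℂ (toComplex A), 1 ≤ ‖μ‖ := by
    unfold IsSchurStable at hs
    push Not at hs
    exact hs
  rw [mem_spectrum_iff_isRoot_charpoly, Polynomial.IsRoot, Matrix.eval_charpoly,
    ← exists_mulVec_eq_zero_iff] at hμ
  obtain ⟨v, hv0, hv⟩ := hμ
  have hAv : toComplex A *ᵥ v = μ • v := by
    rw [sub_mulVec, sub_eq_zero] at hv
    rw [← hv]
    ext i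
    simp [Matrix.scalar_apply, mulVec_diagonal]
  have hCv : toComplex C *ᵥ v ≠ 0 := fun hC =>
    hv0 (h μ hμ1 v (by rw [hAv, toComplex_one, one_mulVec]) hC)
  have ha : A *ᵥ reVec v = μ.re • reVec v - μ.im • imVec v := by
    rw [← reVec_mulVec, hAv]; ext i; simp [reVec, imVec]
  have hb : A *ᵥ imVec v = μ.im • reVec v + μ.re • imVec v := by
    rw [← imVec_mulVec, hAv]; ext i; simp [reVec, imVec]; ring
  have hC : ¬ (C *ᵥ reVec v = 0 ∧ C *ᵥ imVec v = 0) := by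
    rw [← complexVec_eq_zero, ← toComplex_mulVec_complexVec, complexVec_reVec_imVec]
    exact hCv
  -- The injection must be real. For real μ, whichever of Re v, Im v is seen by C is a real
  -- eigenvector; otherwise the pair spans an invariant plane with eigenvalues μ and its conjugate.
  by_cases him : μ.im = 0
  · have hr : 1 ≤ |μ.re| := by
      rwa [← Complex.re_add_im μ, him, Complex.ofReal_zero, zero_mul, add_zero, Complex.norm_real,
        Real.norm_eq_abs] at hμ1
    rw [him, zero_smul, sub_zero] at ha
    rw [him, zero_smul, zero_add] at hb
    by_cases hCa : C *ᵥ reVec v = 0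
    · exact exists_unstableCount_lt_of_real hr hb fun hCb => hC ⟨hCa, hCb⟩
    · exact exists_unstableCount_lt_of_real hr ha hCa
  · exact exists_unstableCount_lt_of_nonreal hμ1 him ha hb hC

-- Gelfand's formula: for r strictly between the spectral radius and 1, eventually ‖M^k‖ ≤ r^k.
attribute [local instance] Matrix.linftyOpNormedRing Matrix.linftyOpNormedAlgebra in
theorem IsSchurStable.tendsto_toComplex_pow {n : ℕ} {M : Matrix (Fin n) (Fin n) ℝ}
    (h : IsSchurStable M) :
    Filter.Tendsto (fun k => toComplex M ^ k) Filter.atTop (nhds 0) := by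
  rcases subsingleton_or_nontrivial (Matrix (Fin n) (Fin n) ℂ) with _ | _
  · simp only [Subsingleton.elim _ (0 : Matrix (Fin n) (Fin n) ℂ)]
    exact tendsto_const_nhds
  have hr : spectralRadius ℂ (toComplex M) < (1 : NNReal) :=
    spectrum.spectralRadius_lt_of_forall_lt _ fun z hz => h z hz
  obtain ⟨r, hr1, hr2⟩ := exists_between hr
  have hG := spectrum.pow_nnnorm_pow_one_div_tendsto_nhds_spectralRadius (toComplex M)
  have hev := hG.eventually_lt_const hr1
  lift r to NNReal using hr2.ne_top
  have hr2' : r < 1 := by exact_mod_cast hr2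
  refine tendsto_zero_iff_norm_tendsto_zero.2 ?_
  refine squeeze_zero' (Filter.Eventually.of_forall fun k => norm_nonneg _) ?_
    (tendsto_pow_atTop_nhds_zero_of_lt_one r.2 (by exact_mod_cast hr2'))
  filter_upwards [hev, Filter.eventually_gt_atTop 0] with k hk hk0
  have hk' : ((‖toComplex M ^ k‖₊ : ENNReal) ^ (1 / k : ℝ)) ^ (k : ℝ) ≤ (r : ENNReal) ^ (k : ℝ) :=
    ENNReal.rpow_le_rpow hk.le (Nat.cast_nonneg k)
  rw [← ENNReal.rpow_mul, one_div, inv_mul_cancel₀ (by positivity), ENNReal.rpow_one,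
    ENNReal.rpow_natCast] at hk'
  exact_mod_cast hk'

theorem IsSchurStable.tendsto_pow_mulVec {n : ℕ} {M : Matrix (Fin n) (Fin n) ℝ}
    (h : IsSchurStable M) (v : Fin n → ℝ) :
    Filter.Tendsto (fun k => M ^ k *ᵥ v) Filter.atTop (nhds 0) := by
  have h1 := h.tendsto_toComplex_pow
  have h2 : Filter.Tendsto (fun k => M ^ k) Filter.atTop (nhds 0) := by
    have hre : Continuous fun N : Matrix (Fin n) (Fin n) ℂ => N.map Complex.re :=
      continuous_id.matrix_map Complex.continuous_re
    have := (hre.tendsto 0).comp h1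
    convert this using 1
    · ext k i j
      rw [Function.comp_apply, ← toComplex_pow]
      rfl
    · congr 1
  have hc : Continuous fun N : Matrix (Fin n) (Fin n) ℝ => N *ᵥ v :=
    continuous_id.matrix_mulVec continuous_const
  have h3 := (hc.tendsto 0).comp h2
  simp only [zero_mulVec] at h3
  exact h3

end Stabilization

/-! ### Trajectories and the slow-fast decomposition. -/

namespace DescriptorSystem

variable {n m p : ℕ} {sys : DescriptorSystem n m p}

section Trajectories

variable {u u' : ℕ → Fin m → ℝ} {x x' : ℕ → Fin n → ℝ} {y y' : ℕ → Fin p → ℝ}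

theorem IsTrajectory.shift (h : sys.IsTrajectory u x y) (j : ℕ) :
    sys.IsTrajectory (fun k => u (j + k)) (fun k => x (j + k)) (fun k => y (j + k)) :=
  fun k => h (j + k)

theorem IsTrajectory.sub (h : sys.IsTrajectory u x y) (h' : sys.IsTrajectory u' x' y') :
    sys.IsTrajectory (fun k => u k - u' k) (fun k => x k - x' k) (fun k => y k - y' k) := by
  intro k
  simp only [mulVec_sub, (h k).1, (h k).2, (h' k).1, (h' k).2, and_true]
  abel

theorem isTrajectory_sum_smul {ι : Type*} [Fintype ι] {u : ι → ℕ → Fin m → ℝ}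
    {x : ι → ℕ → Fin n → ℝ} {y : ι → ℕ → Fin p → ℝ} (g : ι → ℝ)
    (h : ∀ j, sys.IsTrajectory (u j) (x j) (y j)) :
    sys.IsTrajectory (fun k => ∑ j, g j • u j k) (fun k => ∑ j, g j • x j k)
      (fun k => ∑ j, g j • y j k) := by
  intro k
  simp only [mulVec_sum, mulVec_smul, (h _ k).1, (h _ k).2, smul_add, Finset.sum_add_distrib,
    and_self]

/-- The factor c gives access to both real and imaginary parts of μ^k v, through c = 1 and c = -i.
-/
theorem isTrajectory_of_eigenvector {μ : ℂ} {v : Fin n → ℂ}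
    (hv : toComplex sys.A *ᵥ v = μ • (toComplex sys.E *ᵥ v)) (hC : toComplex sys.C *ᵥ v = 0)
    (c : ℂ) :
    sys.IsTrajectory 0 (fun k => reVec ((c * μ ^ k) • v)) 0 := by
  intro k
  constructor
  · rw [← reVec_mulVec, ← reVec_mulVec, mulVec_smul, mulVec_smul, hv, smul_smul, pow_succ,
      mul_assoc]
    simp
  · rw [← reVec_mulVec, mulVec_smul, hC, smul_zero]
    rfl

variable {n₁ n₂ : ℕ} (D : sys.Decomposition n₁ n₂)

theorem Decomposition.blocks_mulVec (h : sys.IsTrajectory u x y) (k : ℕ) :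
    fromBlocks 1 0 0 D.R *ᵥ (D.Pinv *ᵥ x (k + 1)) =
      fromBlocks D.A₁ 0 0 1 *ᵥ (D.Pinv *ᵥ x k) + (D.S * sys.B) *ᵥ u k := by
  rw [← D.decomp_E, ← D.decomp_A, mulVec_mulVec, mulVec_mulVec, Matrix.mul_assoc _ D.P,
    Matrix.mul_assoc _ D.P, D.P_mul_Pinv, Matrix.mul_one, Matrix.mul_one, ← mulVec_mulVec,
    (h k).1, mulVec_add, mulVec_mulVec, mulVec_mulVec]

/-- The fast component of `P⁻¹ x`. -/
def Decomposition.fastState (x : Fin n → ℝ) : Fin n₂ → ℝ :=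
  fun i => (D.Pinv *ᵥ x) (Sum.inr i)

theorem Decomposition.Pinv_mulVec (x : Fin n → ℝ) :
    D.Pinv *ᵥ x = Sum.elim (D.slowState x) (D.fastState x) := by
  ext (i | i) <;> rfl

theorem Decomposition.eq_zero_of_states {x : Fin n → ℝ} (h₁ : D.slowState x = 0)
    (h₂ : D.fastState x = 0) : x = 0 := by
  have : D.P *ᵥ (D.Pinv *ᵥ x) = x := by rw [mulVec_mulVec, D.P_mul_Pinv, one_mulVec]
  rw [← this, D.Pinv_mulVec, h₁, h₂]
  simp

theorem Decomposition.slowState_succ (h : sys.IsTrajectory u x y) {k : ℕ} (hu : u k = 0) :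
    D.slowState (x (k + 1)) = D.A₁ *ᵥ D.slowState (x k) := by
  have := D.blocks_mulVec h k
  rw [hu, mulVec_zero, add_zero, D.Pinv_mulVec, D.Pinv_mulVec, fromBlocks_mulVec,
    fromBlocks_mulVec] at this
  ext i
  simpa using congrFun this (Sum.inl i)

theorem Decomposition.fastState_eq (h : sys.IsTrajectory u x y) {k : ℕ} (hu : u k = 0) :
    D.fastState (x k) = D.R *ᵥ D.fastState (x (k + 1)) := by
  have := D.blocks_mulVec h k
  rw [hu, mulVec_zero, add_zero, D.Pinv_mulVec, D.Pinv_mulVec, fromBlocks_mulVec,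
    fromBlocks_mulVec] at this
  ext i
  simpa using (congrFun this (Sum.inr i)).symm

/-- The fast subsystem runs backwards in time, so its state is determined by present and future
inputs; zero inputs over s steps leave only a factor R^s = 0. -/
theorem Decomposition.fastState_eq_pow (h : sys.IsTrajectory u x y) (j k : ℕ)
    (hu : ∀ i < j, u (k + i) = 0) :
    D.fastState (x k) = D.R ^ j *ᵥ D.fastState (x (k + j)) := by
  induction j with
  | zero => simp
  | succ j ih =>
    rw [ih fun i hi => hu i (by omega), D.fastState_eq h (hu j (by omega)), mulVec_mulVec,
      pow_succ]
    rfl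

theorem Decomposition.fastState_eq_zero (h : sys.IsTrajectory u x y) (k : ℕ)
    (hu : ∀ i < D.s, u (k + i) = 0) : D.fastState (x k) = 0 := by
  rw [D.fastState_eq_pow h D.s k hu, Decomposition.s, pow_nilpotencyClass D.isNilpotent_R,
    zero_mulVec]

/-- This fixes the Hankel depth s + 1: the fast part of x(0) uses u(0), …, u(s-1), that of x(1) uses
u(1), …, u(s), and the slow part of x(1) uses u(0). -/
theorem Decomposition.state_eq_zero (h : sys.IsTrajectory u x y) (h₁ : D.slowState (x 0) = 0)
    (hu : ∀ i ≤ D.s, u i = 0) : x 0 = 0 ∧ x 1 = 0 := by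
  refine ⟨D.eq_zero_of_states h₁ (D.fastState_eq_zero h 0 fun i hi => hu _ (by omega)),
    D.eq_zero_of_states ?_ (D.fastState_eq_zero h 1 fun i hi => hu _ (by omega))⟩
  rw [show 1 = 0 + 1 from rfl, D.slowState_succ h (hu 0 (Nat.zero_le _)), h₁, mulVec_zero]

end Trajectories

/-! ### The Hautus condition, observers and detectability. -/

/-- The finite-dynamics Hautus test of the system. -/
abbrev IsHautusDetectable (sys : DescriptorSystem n m p) : Prop :=
  HautusDetectable sys.E sys.A sys.C

theorem IsObserver.isHautusDetectable {AO : Matrix (Fin n) (Fin n) ℝ}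
    {BOu : Matrix (Fin n) (Fin m) ℝ} {BOy NO : Matrix (Fin n) (Fin p) ℝ}
    (h : sys.IsObserver AO BOu BOy NO) : sys.IsHautusDetectable := by
  intro μ hμ v hv hC
  have key : ∀ c : ℂ, Filter.Tendsto (fun k : ℕ => reVec ((c * μ ^ k) • v)) Filter.atTop
      (nhds 0) := by
    intro c
    -- With zero input and output, the zero estimate satisfies the observer recursion, so the state
    -- itself must decay.
    have := h _ _ _ (isTrajectory_of_eigenvector hv hC c) 0 (by simp)
    rw [tendsto_zero_iff_norm_tendsto_zero]
    simpa using this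
  funext i
  have h1 := ((continuous_apply i).tendsto _).comp (key 1)
  have h2 := ((continuous_apply i).tendsto _).comp (key (-Complex.I))
  have h3 := (h1.norm.add h2.norm)
  have hle : ∀ k : ℕ, ‖v i‖ ≤ ‖reVec (((1 : ℂ) * μ ^ k) • v) i‖ +
      ‖reVec ((-Complex.I * μ ^ k) • v) i‖ := by
    intro k
    have e1 : reVec (((1 : ℂ) * μ ^ k) • v) i = (μ ^ k * v i).re := by simp [reVec]
    have e2 : reVec ((-Complex.I * μ ^ k) • v) i = (μ ^ k * v i).im := by
      simp [reVec]
    rw [e1, e2]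
    calc ‖v i‖ ≤ ‖μ‖ ^ k * ‖v i‖ := le_mul_of_one_le_left (norm_nonneg _) (one_le_pow₀ hμ)
      _ = ‖μ ^ k * v i‖ := by rw [norm_mul, norm_pow]
      _ ≤ _ := Complex.norm_le_abs_re_add_abs_im _
  have := ge_of_tendsto' h3 hle
  simpa using this

/-- A slow eigenvector padded with a zero fast component is an eigenvector of the whole pencil. -/
theorem Decomposition.slowHautusDetectable {n₁ n₂ : ℕ} (D : sys.Decomposition n₁ n₂)
    (h : sys.IsHautusDetectable) :
    HautusDetectable 1 D.A₁ ((sys.C * D.P).submatrix id Sum.inl) := by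
  intro μ hμ v hv hC
  have hPv : toComplex D.P *ᵥ (Sum.elim v 0) = 0 := by
    refine h μ hμ _ ?_ ?_
    · have hS : ∀ w w' : Fin n → ℂ, toComplex D.S *ᵥ w = toComplex D.S *ᵥ w' → w = w' := by
        intro w w' hw
        have := congrArg (toComplex D.Sinv *ᵥ ·) hw
        simpa only [mulVec_mulVec, ← toComplex_mul, D.Sinv_mul_S, toComplex_one, one_mulVec]
          using this
      apply hS
      have e1 : toComplex D.S *ᵥ (toComplex sys.A *ᵥ (toComplex D.P *ᵥ Sum.elim v 0)) =
          toComplex (fromBlocks D.A₁ 0 0 (1 : Matrix (Fin n₂) (Fin n₂) ℝ)) *ᵥ Sum.elim v 0 := by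
        rw [mulVec_mulVec, mulVec_mulVec, ← D.decomp_A, toComplex_mul, toComplex_mul,
          Matrix.mul_assoc]
      have e2 : toComplex D.S *ᵥ (toComplex sys.E *ᵥ (toComplex D.P *ᵥ Sum.elim v 0)) =
          toComplex (fromBlocks 1 0 0 D.R) *ᵥ Sum.elim v 0 := by
        rw [mulVec_mulVec, mulVec_mulVec, ← D.decomp_E, toComplex_mul, toComplex_mul,
          Matrix.mul_assoc]
      rw [mulVec_smul, e1, e2]
      have hb : ∀ (M : Matrix (Fin n₁) (Fin n₁) ℝ) (N : Matrix (Fin n₂) (Fin n₂) ℝ),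
          toComplex (fromBlocks M 0 0 N) *ᵥ Sum.elim v 0 = Sum.elim (toComplex M *ᵥ v) 0 := by
        intro M N
        rw [toComplex, fromBlocks_map, fromBlocks_mulVec]
        ext (i | i)
        · simp [toComplex]
        · simp
      rw [hb, hb, hv]
      ext (i | i) <;> simp
    · rw [mulVec_mulVec, ← toComplex_mul]
      ext i
      have := congrFun hC i
      simpa [mulVec, dotProduct, toComplex] using this
  have := congrArg (toComplex D.Pinv *ᵥ ·) hPv
  simp only [mulVec_mulVec, ← toComplex_mul, D.Pinv_mul_P, toComplex_one, one_mulVec,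
    mulVec_zero] at this
  ext i
  exact congrFun this (Sum.inl i)

theorem IsDetectable.isHautusDetectable (h : sys.IsDetectable) : sys.IsHautusDetectable := by
  obtain ⟨K, hK⟩ := h
  intro μ hμ v hv hC
  by_contra hv0
  refine absurd (hK μ ?_) (not_lt.2 hμ)
  rw [finiteSpectrum, Set.mem_ofPred_eq, ← det_transpose, ← exists_mulVec_eq_zero_iff]
  refine ⟨v, hv0, ?_⟩
  rw [transpose_sub, transpose_smul, ← toComplex_transpose, ← toComplex_transpose,
    transpose_transpose, transpose_add, transpose_transpose, transpose_mul, transpose_transpose,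
    toComplex_add, toComplex_mul, sub_mulVec, add_mulVec, ← mulVec_mulVec, hC, mulVec_zero,
    add_zero, hv, smul_mulVec, sub_self]

theorem Decomposition.isDetectable {n₁ n₂ : ℕ} (D : sys.Decomposition n₁ n₂)
    (h : sys.IsHautusDetectable) : sys.IsDetectable := by
  obtain ⟨F, hF⟩ := exists_isSchurStable_sub_mul _ _ (D.slowHautusDetectable h)
  -- The injection enters only the slow equations, which keeps the closed-loop pencil block
  -- triangular.
  obtain ⟨L, hL⟩ : ∃ L : Matrix (Fin n) (Fin p) ℝ,
      D.S * L = (fromRows (-F) 0 : Matrix (Fin n₁ ⊕ Fin n₂) (Fin p) ℝ) :=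
    ⟨D.Sinv * (fromRows (-F) 0 : Matrix (Fin n₁ ⊕ Fin n₂) (Fin p) ℝ), by
      rw [← Matrix.mul_assoc, D.S_mul_Sinv, Matrix.one_mul]⟩
  refine ⟨Lᵀ, fun μ hμ => hF μ ?_⟩
  rw [finiteSpectrum, Set.mem_ofPred_eq, ← det_transpose] at hμ
  rw [transpose_sub, transpose_smul, ← toComplex_transpose, ← toComplex_transpose,
    transpose_transpose, transpose_add, transpose_transpose, transpose_mul, transpose_transpose,
    transpose_transpose, ← exists_mulVec_eq_zero_iff] at hμ
  obtain ⟨v, hv0, hv⟩ := hμ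
  set C₁ := (sys.C * D.P).submatrix id Sum.inl with hC₁
  have hSAP : D.S * (sys.A + L * sys.C) * D.P = fromBlocks (D.A₁ - F * C₁) (-F * D.C₂) 0 1 := by
    have e : D.S * (L * sys.C) * D.P = fromRows (-F) 0 * fromCols C₁ D.C₂ := by
      have : fromCols C₁ D.C₂ = sys.C * D.P := by ext i (j | j) <;> rfl
      rw [this, ← Matrix.mul_assoc, hL, Matrix.mul_assoc]
    rw [Matrix.mul_add, Matrix.add_mul, D.decomp_A, e, fromRows_mul_fromCols, fromBlocks_add]
    simp [sub_eq_add_neg]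
  have hw0 : toComplex D.Pinv *ᵥ v ≠ 0 := by
    intro h0
    apply hv0
    have := congrArg (toComplex D.P *ᵥ ·) h0
    simpa only [mulVec_mulVec, ← toComplex_mul, D.P_mul_Pinv, toComplex_one, one_mulVec,
      mulVec_zero] using this
  have hw : (μ • toComplex (fromBlocks 1 0 0 D.R) -
      toComplex (fromBlocks (D.A₁ - F * C₁) (-F * D.C₂) 0 1)) *ᵥ (toComplex D.Pinv *ᵥ v) = 0 := by
    have e : ∀ M : Matrix (Fin n) (Fin n) ℝ, toComplex (D.S * M * D.P) *ᵥ (toComplex D.Pinv *ᵥ v) =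
        toComplex D.S *ᵥ (toComplex M *ᵥ v) := by
      intro M
      rw [mulVec_mulVec, ← toComplex_mul, Matrix.mul_assoc, D.P_mul_Pinv, Matrix.mul_one,
        toComplex_mul, mulVec_mulVec]
    rw [← hSAP, ← D.decomp_E, sub_mulVec, smul_mulVec, e, e, ← mulVec_smul, ← mulVec_sub,
      ← smul_mulVec, ← sub_mulVec, hv, mulVec_zero]
  have hdet := exists_mulVec_eq_zero_iff.1 ⟨_, hw0, hw⟩
  have hblock : μ • toComplex (fromBlocks 1 0 0 D.R) -
      toComplex (fromBlocks (D.A₁ - F * C₁) (-F * D.C₂) 0 1) =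
      fromBlocks (μ • 1 - toComplex (D.A₁ - F * C₁)) (-toComplex (-F * D.C₂)) 0
        (μ • toComplex D.R - 1) := by
    have e1 : ∀ {a b c d : ℕ} (M : Matrix (Fin a) (Fin c) ℝ) (N : Matrix (Fin a) (Fin d) ℝ)
        (M' : Matrix (Fin b) (Fin c) ℝ) (N' : Matrix (Fin b) (Fin d) ℝ),
        toComplex (fromBlocks M N M' N') =
          fromBlocks (toComplex M) (toComplex N) (toComplex M') (toComplex N') :=
      fun M N M' N' => fromBlocks_map _ _ _ _ _
    rw [e1, e1, fromBlocks_smul, sub_eq_add_neg, fromBlocks_neg, fromBlocks_add]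
    simp [toComplex_one, toComplex_zero, sub_eq_add_neg]
  rw [hblock, det_fromBlocks_zero₂₁] at hdet
  -- Since μR is nilpotent, μR - 1 is invertible: every finite eigenvalue comes from the slow block.
  have hfast : (μ • toComplex D.R - 1).det ≠ 0 := by
    have hn : IsNilpotent (μ • toComplex D.R) := by
      obtain ⟨k, hk⟩ := D.isNilpotent_R
      exact ⟨k, by rw [smul_pow, ← toComplex_pow, hk, toComplex_zero, smul_zero]⟩
    exact ((isUnit_iff_isUnit_det _).1 hn.isUnit_sub_one).ne_zero
  rw [mem_spectrum_iff_isRoot_charpoly, Polynomial.IsRoot, Matrix.eval_charpoly]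
  rw [Matrix.scalar_apply, ← smul_one_eq_diagonal]
  exact (mul_eq_zero.1 hdet).resolve_right hfast

end DescriptorSystem

/-! ### Observer gains from left inverses of col{E, C}. -/

namespace DescriptorSystem

variable {n m p n₁ n₂ T : ℕ} {sys : DescriptorSystem n m p}

theorem Decomposition.eq_zero_of_fastObservable (D : sys.Decomposition n₁ n₂)
    (hobs : D.FastObservable) {x : Fin n → ℝ} (hE : sys.E *ᵥ x = 0) (hC : sys.C *ᵥ x = 0) :
    x = 0 := by
  have hx : D.P *ᵥ (D.Pinv *ᵥ x) = x := by rw [mulVec_mulVec, D.P_mul_Pinv, one_mulVec]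
  have hz : fromBlocks (1 : Matrix (Fin n₁) (Fin n₁) ℝ) 0 0 D.R *ᵥ (D.Pinv *ᵥ x) = 0 := by
    rw [← D.decomp_E, ← mulVec_mulVec, hx, ← mulVec_mulVec, hE, mulVec_zero]
  rw [D.Pinv_mulVec, fromBlocks_mulVec] at hz
  have h₁ : D.slowState x = 0 := by
    ext i; simpa using congrFun hz (Sum.inl i)
  have hR : D.R *ᵥ D.fastState x = 0 := by
    ext i; simpa using congrFun hz (Sum.inr i)
  have hC₂ : D.C₂ *ᵥ D.fastState x = 0 := by
    rw [← hx, D.Pinv_mulVec, h₁, mulVec_mulVec] at hC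
    ext i
    simpa [mulVec, dotProduct, Decomposition.C₂] using congrFun hC i
  refine D.eq_zero_of_states h₁ (eq_zero_of_mulVec_eq_zero_of_rank D.fastObservabilityMatrix
    (by rw [Fintype.card_fin]; exact hobs) ?_)
  ext ⟨i, j⟩
  -- The row block i = 0 vanishes by C₂z₂ = 0, all later ones by Rz₂ = 0.
  have hi : (D.C₂ * D.R ^ (i : ℕ)) *ᵥ D.fastState x = 0 := by
    rcases Nat.eq_zero_or_pos (i : ℕ) with h0 | h0
    · rw [h0, pow_zero, Matrix.mul_one, hC₂]
    · obtain ⟨k, hk⟩ := Nat.exists_eq_succ_of_ne_zero h0.ne'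
      rw [hk, pow_succ, ← Matrix.mul_assoc, ← mulVec_mulVec, hR, mulVec_zero]
  exact congrFun hi j

/-- All left inverses of `col{E, C}` give observers; some of them have Schur stable error
dynamics. -/
theorem Decomposition.exists_observer_gains (D : sys.Decomposition n₁ n₂)
    (hobs : D.FastObservable) (h : sys.IsHautusDetectable) :
    ∃ (G : Matrix (Fin n) (Fin n) ℝ) (H F : Matrix (Fin n) (Fin p) ℝ),
      G * sys.E + H * sys.C = 1 ∧ IsSchurStable (G * sys.A - F * sys.C) := by
  set M := fromRows sys.E sys.C with hM
  obtain ⟨N, hN⟩ := exists_left_inverse_of_mulVec_eq_zero M fun v hv => by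
    rw [hM, fromRows_mulVec] at hv
    exact D.eq_zero_of_fastObservable hobs (funext fun i => congrFun hv (Sum.inl i))
      (funext fun i => congrFun hv (Sum.inr i))
  set J : Matrix (Fin n ⊕ Fin p) (Fin n) ℝ := fromRows sys.A 0 with hJ
  -- For every F₁, N - F₁(1 - MN) is again a left inverse of M, so choosing it together with the
  -- output gain is one output injection problem for this pair. The pair inherits the Hautus
  -- condition: NJv = μv and (1 - MN)Jv = 0 give Jv = μMv, whose top block is Av = μEv.
  have hd : HautusDetectable 1 (N * J) (fromRows ((1 - M * N) * J) sys.C) := by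
    intro μ hμ v hv hC
    rw [toComplex_fromRows, fromRows_mulVec] at hC
    have h1 : toComplex ((1 - M * N) * J) *ᵥ v = 0 := funext fun i => congrFun hC (Sum.inl i)
    have h2 : toComplex sys.C *ᵥ v = 0 := funext fun i => congrFun hC (Sum.inr i)
    refine h μ hμ v ?_ h2
    rw [toComplex_one, one_mulVec] at hv
    rw [Matrix.sub_mul, Matrix.one_mul, Matrix.mul_assoc, toComplex_sub, toComplex_mul, sub_mulVec,
      ← mulVec_mulVec, hv, mulVec_smul, sub_eq_zero, hJ, hM, toComplex_fromRows,
      toComplex_fromRows, fromRows_mulVec, fromRows_mulVec] at h1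
    exact funext fun i => congrFun h1 (Sum.inl i)
  obtain ⟨F, hF⟩ := exists_isSchurStable_sub_mul _ _ hd
  set K : Matrix (Fin n) (Fin n ⊕ Fin p) ℝ := N - F.toCols₁ * (1 - M * N) with hK
  refine ⟨K.toCols₁, K.toCols₂, F.toCols₂, ?_, ?_⟩
  · rw [← fromCols_mul_fromRows, fromCols_toCols, ← hM, hK, Matrix.sub_mul, hN, Matrix.mul_assoc,
      Matrix.sub_mul, Matrix.mul_assoc M, hN]
    simp
  · have e1 : K.toCols₁ * sys.A = K * J := by
      conv_rhs => rw [← fromCols_toCols K, hJ, fromCols_mul_fromRows, Matrix.mul_zero, add_zero]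
    have e2 : F * fromRows ((1 - M * N) * J) sys.C =
        F.toCols₁ * ((1 - M * N) * J) + F.toCols₂ * sys.C := by
      conv_lhs => rw [← fromCols_toCols F, fromCols_mul_fromRows]
    rw [e2] at hF
    rw [e1, hK, Matrix.sub_mul, Matrix.mul_assoc, sub_sub]
    exact hF

end DescriptorSystem

/-! ### Data matrices and rich data. -/

namespace HistoricalData

open DescriptorSystem

variable {n m p n₁ n₂ T s : ℕ} {sys : DescriptorSystem n m p}

theorem mulVec_eq_sum_smul {ι : Type*} {T : ℕ} (f : Fin T → ι → ℝ) (g : Fin T → ℝ) :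
    (Matrix.of fun i k => f k i) *ᵥ g = ∑ k, g k • f k := by
  ext i
  simp [mulVec, dotProduct, mul_comm]

theorem CollectedFrom.E_mul_Xf {d : HistoricalData n m p T s} (h : d.CollectedFrom sys) :
    sys.E * d.Xf = sys.A * d.Xp + sys.B * d.Up := by
  obtain ⟨u, x, y, ht, hu, hx, hy⟩ := h
  ext i k
  simpa [Xf, Xp, Up, hu, hx, Matrix.mul_apply, mulVec, dotProduct] using congrFun (ht k).1 i

theorem CollectedFrom.C_mul_Xp {d : HistoricalData n m p T s} (h : d.CollectedFrom sys) :
    sys.C * d.Xp = d.Yp := by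
  obtain ⟨u, x, y, ht, hu, hx, hy⟩ := h
  ext i k
  simpa [Yp, Xp, hy, hx, Matrix.mul_apply, mulVec, dotProduct] using (congrFun (ht k).2 i).symm

theorem CollectedFrom.C_mul_Xf {d : HistoricalData n m p T s} (h : d.CollectedFrom sys) :
    sys.C * d.Xf = d.Yf := by
  obtain ⟨u, x, y, ht, hu, hx, hy⟩ := h
  ext i k
  simpa [Yf, Xf, hy, hx, Matrix.mul_apply, mulVec, dotProduct] using
    (congrFun (ht (k + 1)).2 i).symm

/-- Rich data generate every pair of consecutive samples of every trajectory. -/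
theorem IsRich.exists_combination {D : sys.Decomposition n₁ n₂}
    {d : HistoricalData n m p T D.s} (hrich : IsRich D d) (hd : d.CollectedFrom sys)
    {u : ℕ → Fin m → ℝ} {x : ℕ → Fin n → ℝ} {y : ℕ → Fin p → ℝ} (h : sys.IsTrajectory u x y) :
    ∃ g : Fin T → ℝ, d.Xp *ᵥ g = x 0 ∧ d.Up *ᵥ g = u 0 ∧ d.Xf *ᵥ g = x 1 := by
  obtain ⟨ud, xd, yd, ht, hu, hx, hy⟩ := hd
  obtain ⟨g, hg⟩ := mulVec_surjective_of_rank_eq_card _ (hrich.trans (by simp))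
    (Sum.elim (fun i => D.slowState (x 0) i.2) fun i => u i.1 i.2)
  rw [fromRows_mulVec] at hg
  -- The time shifts of the recorded trajectory are combined with weights g. The difference from the
  -- target starts at zero slow state with s + 1 zero inputs, so its first two states vanish.
  have hcomb := isTrajectory_sum_smul g fun j : Fin T => ht.shift j
  have hu' : ∀ i ≤ D.s, ∑ j : Fin T, g j • ud (j + i) = u i := by
    intro i hi
    ext l
    have := congrFun hg (Sum.inr (⟨i, by omega⟩, l))
    simpa [hankel, mulVec, dotProduct, hu, mul_comm] using this
  have hslow : D.slowState (∑ j : Fin T, g j • xd (j + 0) - x 0) = 0 := by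
    ext l
    have := congrFun hg (Sum.inl (0, l))
    have e : D.slowState (∑ j : Fin T, g j • xd j) l = D.slowState (x 0) l := by
      rw [← show _ = D.slowState (x 0) l from this]
      simp [Decomposition.slowState, mulVec_sum, mulVec_smul, hankel, hx]
      simp [mulVec, dotProduct, mul_comm]
    simp only [Decomposition.slowState, mulVec_sub, Pi.sub_apply, Pi.zero_apply, add_zero] at e ⊢
    rw [e, sub_self]
  obtain ⟨h0, h1⟩ := D.state_eq_zero (hcomb.sub h) hslow fun i hi => by rw [hu' i hi, sub_self]
  refine ⟨g, ?_, ?_, ?_⟩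
  · rw [← sub_eq_zero.1 h0]
    exact (mulVec_eq_sum_smul _ _).trans (Finset.sum_congr rfl fun k _ => by rw [hx]; rfl)
  · rw [← hu' 0 (Nat.zero_le _)]
    exact (mulVec_eq_sum_smul _ _).trans (Finset.sum_congr rfl fun k _ => by rw [hu]; rfl)
  · rw [← sub_eq_zero.1 h1]
    exact (mulVec_eq_sum_smul _ _).trans (Finset.sum_congr rfl fun k _ => by rw [hx]; rfl)

/-- Multiply X_f by GE + HC = 1 and substitute the system equations; F is free because Y_p = CX_p
lets FY_p cancel FCX_p. -/
theorem CollectedFrom.Xf_eq {d : HistoricalData n m p T s} (hd : d.CollectedFrom sys)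
    {G : Matrix (Fin n) (Fin n) ℝ} {H F : Matrix (Fin n) (Fin p) ℝ}
    (hGH : G * sys.E + H * sys.C = 1) :
    d.Xf = (G * sys.A - F * sys.C) * d.Xp + (G * sys.B) * d.Up + F * d.Yp + H * d.Yf := by
  have e : d.Xf = (G * sys.E + H * sys.C) * d.Xf := by rw [hGH, Matrix.one_mul]
  rw [e, Matrix.add_mul, Matrix.mul_assoc, Matrix.mul_assoc, hd.E_mul_Xf, hd.C_mul_Xf,
    ← hd.C_mul_Xp, Matrix.mul_add, Matrix.sub_mul]
  simp only [Matrix.mul_assoc]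
  abel

theorem IsRich.isObserver {D : sys.Decomposition n₁ n₂} {d : HistoricalData n m p T D.s}
    (hrich : IsRich D d) (hd : d.CollectedFrom sys) {SXp : Matrix (Fin n) (Fin n) ℝ}
    {SUp : Matrix (Fin n) (Fin m) ℝ} {SYp SYf : Matrix (Fin n) (Fin p) ℝ}
    (hX : d.Xf = SXp * d.Xp + SUp * d.Up + SYp * d.Yp + SYf * d.Yf) (hS : IsSchurStable SXp) :
    sys.IsObserver SXp SUp SYp SYf := by
  intro u x y ht xhat hxhat
  have hstep : ∀ k, x (k + 1) = SXp *ᵥ x k + SUp *ᵥ u k + SYp *ᵥ y k + SYf *ᵥ y (k + 1) := by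
    intro k
    obtain ⟨g, hg0, hgu, hg1⟩ := hrich.exists_combination hd (ht.shift k)
    have hy0 : d.Yp *ᵥ g = y k := by
      rw [← hd.C_mul_Xp, ← mulVec_mulVec, hg0, (ht k).2]; rfl
    have hy1 : d.Yf *ᵥ g = y (k + 1) := by
      rw [← hd.C_mul_Xf, ← mulVec_mulVec, hg1, (ht (k + 1)).2]
    have := congrArg (· *ᵥ g) hX
    simp only [add_mulVec, ← mulVec_mulVec, hg0, hgu, hg1, hy0, hy1] at this
    exact this
  have herr : ∀ k, x k - xhat k = SXp ^ k *ᵥ (x 0 - xhat 0) := by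
    intro k
    induction k with
    | zero => simp
    | succ k ih =>
      rw [pow_succ', ← mulVec_mulVec, ← ih, hstep, hxhat, mulVec_sub]
      abel
  have hlim := (hS.tendsto_pow_mulVec (x 0 - xhat 0)).norm
  rw [norm_zero] at hlim
  exact hlim.congr fun k => by rw [herr k]

/-- The substitution is v = X_p g: a kernel vector g gives an eigenvector in ker C, and richness
provides a g for every such v. -/
theorem IsRich.isHautusDetectable_iff {D : sys.Decomposition n₁ n₂}
    {d : HistoricalData n m p T D.s} (hrich : IsRich D d) (hd : d.CollectedFrom sys) :
    sys.IsHautusDetectable ↔ ∀ μ : ℂ, 1 ≤ ‖μ‖ → ∀ g : Fin T → ℂ,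
      (μ • toComplex d.Xp - toComplex d.Xf) *ᵥ g = 0 → toComplex d.Up *ᵥ g = 0 →
      toComplex d.Yp *ᵥ g = 0 → toComplex d.Yf *ᵥ g = 0 → toComplex d.Xp *ᵥ g = 0 := by
  constructor
  · intro h μ hμ g hX hU hY _
    refine h μ hμ _ ?_ ?_
    · rw [sub_mulVec, smul_mulVec, sub_eq_zero] at hX
      rw [← mulVec_smul, hX, mulVec_mulVec, mulVec_mulVec, ← toComplex_mul, ← toComplex_mul,
        hd.E_mul_Xf, toComplex_add, add_mulVec, toComplex_mul _ d.Up, ← mulVec_mulVec _ _ _,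
        hU, mulVec_zero, add_zero]
    · rw [mulVec_mulVec, ← toComplex_mul, hd.C_mul_Xp, hY]
  · intro h μ hμ v hv hC
    obtain ⟨a, ha0, hau, ha1⟩ :=
      hrich.exists_combination hd (isTrajectory_of_eigenvector hv hC 1)
    obtain ⟨b, hb0, hbu, hb1⟩ :=
      hrich.exists_combination hd (isTrajectory_of_eigenvector hv hC (-Complex.I))
    -- The combinations a and b reproduce Re(μ^k v) and Im(μ^k v) at k = 0, 1, so g = a + ib
    -- reproduces v and μv.
    have h0 : toComplex d.Xp *ᵥ complexVec a b = v := by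
      rw [toComplex_mulVec_complexVec, ha0, hb0]
      ext i
      apply Complex.ext <;> simp [complexVec, reVec]
    have h1 : toComplex d.Xf *ᵥ complexVec a b = μ • v := by
      rw [toComplex_mulVec_complexVec, ha1, hb1]
      ext i
      apply Complex.ext <;> simp [complexVec, reVec]
    rw [← h0]
    refine h μ hμ _ ?_ ?_ ?_ ?_
    · rw [sub_mulVec, smul_mulVec, h0, h1, sub_self]
    · rw [toComplex_mulVec_complexVec, hau, hbu, complexVec_eq_zero]
      exact ⟨rfl, rfl⟩
    · rw [← hd.C_mul_Xp, toComplex_mul, ← mulVec_mulVec, h0, hC]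
    · rw [← hd.C_mul_Xf, toComplex_mul, ← mulVec_mulVec, h1, mulVec_smul, hC, smul_zero]

theorem rank_condition_iff {D : sys.Decomposition n₁ n₂} (hobs : D.FastObservable)
    {d : HistoricalData n m p T s} (hd : d.CollectedFrom sys) (μ : ℂ) :
    (fromRows (μ • toComplex d.Xp - toComplex d.Xf)
          (fromRows (toComplex d.Up) (fromRows (toComplex d.Yp) (toComplex d.Yf)))).rank
          = (fromRows d.Xp (fromRows d.Up d.Yf)).rank ↔
    ∀ g : Fin T → ℂ,
      (μ • toComplex d.Xp - toComplex d.Xf) *ᵥ g = 0 → toComplex d.Up *ᵥ g = 0 →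
      toComplex d.Yp *ᵥ g = 0 → toComplex d.Yf *ᵥ g = 0 → toComplex d.Xp *ᵥ g = 0 := by
  have hrows : ∀ {ι κ : Type} (M : Matrix ι (Fin T) ℂ) (N : Matrix κ (Fin T) ℂ) (g : Fin T → ℂ),
      fromRows M N *ᵥ g = 0 ↔ M *ᵥ g = 0 ∧ N *ᵥ g = 0 := by
    intro ι κ M N g
    rw [fromRows_mulVec]
    simp [funext_iff]
  rw [← rank_toComplex, toComplex_fromRows, toComplex_fromRows, rank_eq_iff_of_ker_le]
  · simp only [hrows, and_imp]
    exact ⟨fun h g h1 h2 h3 h4 => (h g h1 h2 h3 h4).1,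
      fun h g h1 h2 h3 h4 => ⟨h g h1 h2 h3 h4, h2, h4⟩⟩
  · simp only [hrows, and_imp]
    intro g hX hU hY
    have hYp : toComplex d.Yp *ᵥ g = 0 := by
      rw [← hd.C_mul_Xp, toComplex_mul, ← mulVec_mulVec, hX, mulVec_zero]
    have hE : toComplex sys.E *ᵥ (toComplex d.Xf *ᵥ g) = 0 := by
      rw [mulVec_mulVec, ← toComplex_mul, hd.E_mul_Xf, toComplex_add, toComplex_mul,
        toComplex_mul, add_mulVec, ← mulVec_mulVec, ← mulVec_mulVec, hX, hU, mulVec_zero,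
        mulVec_zero, add_zero]
    have hC : toComplex sys.C *ᵥ (toComplex d.Xf *ᵥ g) = 0 := by
      rw [mulVec_mulVec, ← toComplex_mul, hd.C_mul_Xf, hY]
    -- E and C both kill X_f g; fast observability, applied to its real and imaginary parts, makes
    -- it zero. This gives the kernel inclusion valid for every μ.
    have hXf : toComplex d.Xf *ᵥ g = 0 := by
      have h1 := reVec_mulVec sys.E (toComplex d.Xf *ᵥ g)
      have h2 := imVec_mulVec sys.E (toComplex d.Xf *ᵥ g)
      have h3 := reVec_mulVec sys.C (toComplex d.Xf *ᵥ g)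
      have h4 := imVec_mulVec sys.C (toComplex d.Xf *ᵥ g)
      rw [hE] at h1 h2
      rw [hC] at h3 h4
      rw [← complexVec_reVec_imVec (toComplex d.Xf *ᵥ g), complexVec_eq_zero]
      exact ⟨D.eq_zero_of_fastObservable hobs h1.symm h3.symm,
        D.eq_zero_of_fastObservable hobs h2.symm h4.symm⟩
    refine ⟨?_, hU, hYp, hY⟩
    rw [sub_mulVec, smul_mulVec, hX, hXf, smul_zero, sub_zero]

end HistoricalData

theorem mainTheorem1 {n m p n₁ n₂ T : ℕ} (sys : DescriptorSystem n m p)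
    (hreg : sys.IsRegular) (D : sys.Decomposition n₁ n₂) (hobs : D.FastObservable)
    (d : HistoricalData n m p T D.s) (hd : d.CollectedFrom sys)
    (hrich : HistoricalData.IsRich D d) :
    List.TFAE [
      ∃ (AO : Matrix (Fin n) (Fin n) ℝ) (BOu : Matrix (Fin n) (Fin m) ℝ)
        (BOy NO : Matrix (Fin n) (Fin p) ℝ), sys.IsObserver AO BOu BOy NO,
      ∃ (SXp : Matrix (Fin n) (Fin n) ℝ) (SUp : Matrix (Fin n) (Fin m) ℝ)
        (SYp SYf : Matrix (Fin n) (Fin p) ℝ),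
        d.Xf = SXp * d.Xp + SUp * d.Up + SYp * d.Yp + SYf * d.Yf ∧ IsSchurStable SXp,
      ∀ μ : ℂ, 1 ≤ ‖μ‖ →
        (fromRows (μ • toComplex d.Xp - toComplex d.Xf)
          (fromRows (toComplex d.Up) (fromRows (toComplex d.Yp) (toComplex d.Yf)))).rank
          = (fromRows d.Xp (fromRows d.Up d.Yf)).rank,
      sys.IsDetectable] := by
  tfae_have 2 → 1 := by
    rintro ⟨SXp, SUp, SYp, SYf, hX, hS⟩
    exact ⟨SXp, SUp, SYp, SYf, hrich.isObserver hd hX hS⟩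
  tfae_have 1 → 4 := by
    rintro ⟨AO, BOu, BOy, NO, h⟩
    exact D.isDetectable h.isHautusDetectable
  tfae_have 4 → 2 := by
    intro h
    obtain ⟨G, H, F, hGH, hS⟩ := D.exists_observer_gains hobs h.isHautusDetectable
    exact ⟨_, _, _, _, hd.Xf_eq hGH, hS⟩
  tfae_have 3 ↔ 4 := by
    simp only [HistoricalData.rank_condition_iff hobs hd]
    rw [← hrich.isHautusDetectable_iff hd]
    exact ⟨D.isDetectable, fun h => h.isHautusDetectable⟩
  tfae_finish
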